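/- Let $n\ge 0$ and $w\in S_n$. For $u\in S_n$ put $\boldsymbol{u}=(u^{-1}(1),\dots,u^{-1}(n))\in\mathbb{R}^n$, and let $Q_w=\operatorname{conv}\{\boldsymbol{u} : u\preceq w\}\subset\mathbb{R}^n$ be the Bruhat interval polytope, where $\preceq$ is the (strong) Bruhat order on $S_n$: the reflexive transitive closure of the relations $u\prec ut$ with $t$ a transposition and $\ell(ut)=\ell(u)+1$, where $\ell$ is the Coxeter length with respect to the adjacent transpositions. Then $Q_w$ is a directionally simple polytope with respect to the cost vector $c=(n,n-1,\dots,1)$. That is, $c$ is generic (not orthogonal to any edge of $Q_w$), and, if each edge of $Q_w$ is oriented in the direction of greater inner product with $c$, then for every vertex $v$ of $Q_w$ and every set $E$ of edges with source $v$ there is a face $F$ of $Q_w$ containing $v$ whose set of edges incident to $v$ is exactly $E$. -/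

import Mathlib

/-! ### Length and Bruhat order on the symmetric group -/

/-- The simple generators of the group of permutations of `Fin n`: the adjacent
transpositions. -/
def IsSimpleGen {n : ℕ} (s : Equiv.Perm (Fin n)) : Prop :=
  ∃ i j : Fin n, (j : ℕ) = (i : ℕ) + 1 ∧ s = Equiv.swap i j

/-- Every permutation is a product of adjacent transpositions. -/
theorem exists_simpleWord {n : ℕ} (w : Equiv.Perm (Fin n)) :
    ∃ l : List (Equiv.Perm (Fin n)), (∀ s ∈ l, IsSimpleGen s) ∧ l.prod = w := by
  cases n with
  | zero => exact ⟨[], by simp, Subsingleton.elim _ _⟩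
  | succ m =>
    have h : w ∈ Submonoid.closure
        (Set.range fun i : Fin m => Equiv.swap i.castSucc i.succ) := by
      rw [Equiv.Perm.mclosure_swap_castSucc_succ]
      trivial
    obtain ⟨l, hl, hw⟩ := Submonoid.exists_list_of_mem_closure h
    refine ⟨l, fun s hs => ?_, hw⟩
    obtain ⟨i, rfl⟩ := hl s hs
    exact ⟨i.castSucc, i.succ, by simp, rfl⟩

/-- The Coxeter length of `w`: the least number of factors in an expression of `w` as a product
of simple generators (the infimum is over a nonempty set by `exists_simpleWord`). -/
noncomputable def permLength {n : ℕ} (w : Equiv.Perm (Fin n)) : ℕ :=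
  sInf {k : ℕ | ∃ l : List (Equiv.Perm (Fin n)),
    l.length = k ∧ (∀ s ∈ l, IsSimpleGen s) ∧ l.prod = w}

/-- The cover relation of the (strong) Bruhat order: `v = u * t` for a transposition `t`, and the
length goes up by exactly one. -/
def BruhatCovers {n : ℕ} (u v : Equiv.Perm (Fin n)) : Prop :=
  ∃ t : Equiv.Perm (Fin n), t.IsSwap ∧ v = u * t ∧ permLength v = permLength u + 1

/-- The (strong) Bruhat order. -/
def BruhatLE {n : ℕ} (u v : Equiv.Perm (Fin n)) : Prop :=
  Relation.ReflTransGen BruhatCovers u v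

/-! ### Bruhat interval polytopes -/

/-- The vector `(u⁻¹(1), …, u⁻¹(n))`, where the element `k` of `Fin n` stands for `k + 1`. -/
def permVec {n : ℕ} (u : Equiv.Perm (Fin n)) : Fin n → ℝ :=
  fun i => ((u⁻¹ i : Fin n) : ℝ) + 1

/-- The Bruhat interval polytope `Q_w`. -/
def bruhatIntervalPolytope {n : ℕ} (w : Equiv.Perm (Fin n)) : Set (Fin n → ℝ) :=
  convexHull ℝ {x | ∃ u : Equiv.Perm (Fin n), BruhatLE u w ∧ x = permVec u}

/-- The cost vector `(n, n - 1, …, 1)`. -/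
def costVec (n : ℕ) : Fin n → ℝ :=
  fun i => (n : ℝ) - (i : ℝ)

/-! ### Directionally simple polytopes

The nonempty faces of a polytope are its nonempty exposed subsets, its vertices are its extreme
points, and its edges are its one-dimensional faces, that is, the faces that are segments with
distinct end points. -/

/-- A polytope is the convex hull of a finite set. -/
def IsPolytope {d : ℕ} (Q : Set (Fin d → ℝ)) : Prop :=
  ∃ S : Set (Fin d → ℝ), S.Finite ∧ Q = convexHull ℝ S

/-- `x` and `y` are the two end points of an edge of `Q`. -/
def IsEdge {d : ℕ} (Q : Set (Fin d → ℝ)) (x y : Fin d → ℝ) : Prop :=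
  x ≠ y ∧ IsExposed ℝ Q (segment ℝ x y)

/-- The cost vector `c` is orthogonal to no edge of `Q`. -/
def IsGenericCost {d : ℕ} (Q : Set (Fin d → ℝ)) (c : Fin d → ℝ) : Prop :=
  ∀ x y : Fin d → ℝ, IsEdge Q x y → c ⬝ᵥ (y - x) ≠ 0

/-- `x → y` is an edge of `G_c(Q)`, the graph of `Q` oriented in the direction of greater inner
product with `c`. -/
def IsUpwardEdge {d : ℕ} (Q : Set (Fin d → ℝ)) (c x y : Fin d → ℝ) : Prop :=
  IsEdge Q x y ∧ c ⬝ᵥ x < c ⬝ᵥ y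

/-- `Q` is a polytope, `c` is generic for `Q`, and for every vertex `v` and every set of edges of
`G_c(Q)` with source `v` there is a face `F` of `Q` containing `v` whose set of edges incident to
`v` is exactly the given set. An edge incident to `v` is given by its other end point, and the
edges of the face `F` are the edges of `Q` contained in `F`. -/
def IsDirectionallySimple {d : ℕ} (Q : Set (Fin d → ℝ)) (c : Fin d → ℝ) : Prop :=
  IsPolytope Q ∧ IsGenericCost Q c ∧
    ∀ v ∈ Q.extremePoints ℝ, ∀ E : Set (Fin d → ℝ), (∀ y ∈ E, IsUpwardEdge Q c v y) →
      ∃ F : Set (Fin d → ℝ), IsExposed ℝ Q F ∧ v ∈ F ∧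
        {y | IsEdge Q v y ∧ segment ℝ v y ⊆ F} = E

/-! Rank matrices turn the Bruhat order into the system of inequalities `RankLE`. By
`permVec_eq_sum`, `permVec v` is a constant vector minus the sum of the indicators of the prefixes
of `v`. In each column the prefix of `v` satisfies a Gale-type bound coming from `w`. Exchanging
elements column by column shows that the cone of `Q_w` at a vertex `u ≤ w` is generated by the
vectors `e_{u p} - e_{u q}` with `p < q` and `u (p q) ≤ w` (`permVec_sub_permVec_mem_closure`).
Hence every edge at `u` comes from an indecomposable arc `RankCover w u p q`. Along it the cost
changes by `(q - p) (u q - u p)`, so the cost is generic and the upward edges are the covers with `u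
p < u q`.

A face through `u` containing a prescribed set of upward edges and no other edge at `u` amounts to a
height `f` on positions that is weakly increasing along all arcs, constant along the chosen covers
and strictly increasing along all other covers: the functional with coefficient `f p` at coordinate
`u p` then exposes the face.

Such an `f` exists for planarity reasons. Draw the points `(p, u p)`. Every pair in north-west to
south-east position is an arc, so indecomposability forces the upward covers to form disjoint
increasing paths with empty rectangles that do not cross. Removing one path at a time from the
north-west gives a height constant on paths and increasing to the south-east (`exists_height`). A
small perturbation along the paths (`exists_arc_count`) separates the chosen covers from the others.
-/

/-! ### Coxeter length and inversions -/

/-- The inversions of a permutation of `Fin n`. -/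
def permInversions {n : ℕ} (u : Equiv.Perm (Fin n)) : Finset (Fin n × Fin n) :=
  Finset.univ.filter fun x => x.1 < x.2 ∧ u x.2 < u x.1

theorem mem_permInversions {n : ℕ} {u : Equiv.Perm (Fin n)} {x y : Fin n} :
    (x, y) ∈ permInversions u ↔ x < y ∧ u y < u x := by
  simp [permInversions]

theorem swap_adjacent_lt {n : ℕ} {i j : Fin n} (hij : (j : ℕ) = i + 1) {x y : Fin n}
    (hxy : x < y) (hne : (x, y) ≠ (i, j)) : Equiv.swap i j x < Equiv.swap i j y := by
  have hne' : ¬ (x = i ∧ y = j) := fun h => hne (by rw [h.1, h.2])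
  rw [Equiv.swap_apply_def, Equiv.swap_apply_def]
  rw [Fin.ext_iff, Fin.ext_iff] at hne'
  split_ifs with h1 h2 h3 h4 h5 h6 h7 h8 <;> simp only [Fin.ext_iff, Fin.lt_def] at * <;> omega

theorem card_permInversions_mul_adjacent {n : ℕ} (u : Equiv.Perm (Fin n)) {i j : Fin n}
    (hij : (j : ℕ) = i + 1) (h : u i < u j) :
    (permInversions (u * Equiv.swap i j)).card = (permInversions u).card + 1 := by
  have hlt : i < j := by rw [Fin.lt_def]; omega
  let φ : Fin n × Fin n ≃ Fin n × Fin n := Equiv.prodCongr (Equiv.swap i j) (Equiv.swap i j)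
  have key : permInversions (u * Equiv.swap i j)
      = insert (i, j) ((permInversions u).map φ.toEmbedding) := by
    ext ⟨x, y⟩
    rw [Finset.mem_insert, Finset.mem_map_equiv, mem_permInversions]
    simp only [φ, Equiv.prodCongr_symm, Equiv.symm_swap, Equiv.prodCongr_apply, Prod.map_apply,
      mem_permInversions, Equiv.Perm.mul_apply]
    by_cases hxy : (x, y) = (i, j)
    · simp only [Prod.mk.injEq] at hxy
      simp [hxy.1, hxy.2, hlt, h]
    · simp only [hxy, false_or]
      refine ⟨fun ⟨h1, h2⟩ => ⟨swap_adjacent_lt hij h1 hxy, h2⟩, fun ⟨h1, h2⟩ => ⟨?_, h2⟩⟩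
      have := swap_adjacent_lt hij h1 (fun he => ?_)
      · simpa using this
      · simp only [Prod.mk.injEq] at he
        rw [he.1, he.2] at h2
        exact absurd h2 h.not_gt
  rw [key, Finset.card_insert_of_notMem, Finset.card_map]
  rw [Finset.mem_map_equiv]
  simp only [φ, Equiv.prodCongr_symm, Equiv.symm_swap, Equiv.prodCongr_apply, Prod.map_apply,
    mem_permInversions, Equiv.swap_apply_left, Equiv.swap_apply_right]
  exact fun h' => h'.1.not_gt hlt

theorem card_permInversions_mul_adjacent' {n : ℕ} (u : Equiv.Perm (Fin n)) {i j : Fin n}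
    (hij : (j : ℕ) = i + 1) (h : u j < u i) :
    (permInversions (u * Equiv.swap i j)).card + 1 = (permInversions u).card := by
  have := card_permInversions_mul_adjacent (u * Equiv.swap i j) hij (by simpa using h)
  rw [← this, mul_assoc, Equiv.swap_mul_self, mul_one]

theorem card_permInversions_prod_le {n : ℕ} (l : List (Equiv.Perm (Fin n)))
    (hl : ∀ s ∈ l, IsSimpleGen s) : (permInversions l.prod).card ≤ l.length := by
  induction l using List.reverseRecOn with
  | nil =>
    have : permInversions (1 : Equiv.Perm (Fin n)) = ∅ := by
      ext ⟨x, y⟩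
      rw [mem_permInversions]
      simpa using fun h => le_of_lt h
    simp [this]
  | append_singleton l s ih =>
    have ih := ih fun t ht => hl t (by simp [ht])
    obtain ⟨i, j, hij, rfl⟩ := hl s (by simp)
    have hne : i ≠ j := fun h => by rw [h] at hij; omega
    rw [List.prod_append, List.prod_singleton, List.length_append, List.length_singleton]
    rcases lt_or_gt_of_ne (l.prod.injective.ne hne) with h | h
    · have := card_permInversions_mul_adjacent l.prod hij h
      omega
    · have := card_permInversions_mul_adjacent' l.prod hij h
      omega

theorem eq_one_of_forall_adjacent_lt {n : ℕ} (u : Equiv.Perm (Fin n))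
    (h : ∀ i j : Fin n, (j : ℕ) = i + 1 → u i < u j) : u = 1 := by
  cases n with
  | zero => exact Subsingleton.elim _ _
  | succ m =>
    have hu : StrictMono u := Fin.strictMono_iff_lt_succ.2 fun i => h _ _ (by simp)
    have := (StrictMono.range_inj hu strictMono_id).1 (by rw [u.surjective.range_eq]; simp)
    ext x
    simp [this]

/-- Bubble sort: a permutation other than the identity has an adjacent descent, and undoing it
removes exactly one inversion. -/
theorem exists_simpleWord_length_eq {n : ℕ} (k : ℕ) (u : Equiv.Perm (Fin n))
    (hk : (permInversions u).card = k) :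
    ∃ l : List (Equiv.Perm (Fin n)), l.length = k ∧ (∀ s ∈ l, IsSimpleGen s) ∧ l.prod = u := by
  induction k generalizing u with
  | zero =>
    refine ⟨[], rfl, by simp, ?_⟩
    rw [Finset.card_eq_zero] at hk
    refine (eq_one_of_forall_adjacent_lt u fun i j hij => ?_).symm
    have hlt : i < j := by rw [Fin.lt_def]; omega
    by_contra hcon
    have : (i, j) ∈ permInversions u :=
      mem_permInversions.2 ⟨hlt, lt_of_le_of_ne (not_lt.1 hcon) (u.injective.ne hlt.ne')⟩
    simp [hk] at this
  | succ k ih =>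
    have hu : ∃ i j : Fin n, (j : ℕ) = i + 1 ∧ u j < u i := by
      by_contra! hcon
      have h1 : u = 1 := eq_one_of_forall_adjacent_lt u fun i j hij =>
        lt_of_le_of_ne (hcon i j hij) (u.injective.ne fun h => by rw [h] at hij; omega)
      have := card_permInversions_prod_le (n := n) [] (by simp)
      rw [List.prod_nil, ← h1, hk] at this
      simp at this
    obtain ⟨i, j, hij, h⟩ := hu
    have := card_permInversions_mul_adjacent' u hij h
    obtain ⟨l, hl, hs, hp⟩ := ih (u * Equiv.swap i j) (by omega)
    refine ⟨l ++ [Equiv.swap i j], by simp [hl], fun s h' => ?_, ?_⟩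
    · rcases List.mem_append.1 h' with h' | h'
      · exact hs s h'
      · exact ⟨i, j, hij, by simpa using h'⟩
    · rw [List.prod_append, hp, List.prod_singleton, mul_assoc, Equiv.swap_mul_self, mul_one]

theorem permLength_eq_card_permInversions {n : ℕ} (u : Equiv.Perm (Fin n)) :
    permLength u = (permInversions u).card := by
  apply le_antisymm
  · exact Nat.sInf_le (exists_simpleWord_length_eq _ u rfl)
  · refine le_csInf ⟨_, exists_simpleWord_length_eq _ u rfl⟩ ?_
    rintro k ⟨l, rfl, hl, rfl⟩
    exact card_permInversions_prod_le l hl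

theorem card_permInversions_mul_swap {n : ℕ} (d : ℕ) (u : Equiv.Perm (Fin n)) (p q : Fin n)
    (hd : (q : ℕ) = p + d + 1) (h : u p < u q) :
    (permInversions u).card < (permInversions (u * Equiv.swap p q)).card ∧
      ((∀ s, p < s → s < q → u p < u s → ¬ u s < u q) →
        (permInversions (u * Equiv.swap p q)).card = (permInversions u).card + 1) := by
  induction d generalizing u p with
  | zero =>
    have := card_permInversions_mul_adjacent u (by omega) h
    exact ⟨by omega, fun _ => this⟩
  | succ d ih =>
    obtain ⟨p', hp'⟩ : ∃ p' : Fin n, (p' : ℕ) = p + 1 := ⟨⟨p + 1, by omega⟩, rfl⟩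
    have hpp' : p ≠ p' := by rw [Ne, Fin.ext_iff]; omega
    have hqp : q ≠ p := by rw [Ne, Fin.ext_iff]; omega
    have hqp' : q ≠ p' := by rw [Ne, Fin.ext_iff]; omega
    set σ := Equiv.swap p p' with hσ
    have hσq : σ q = q := Equiv.swap_apply_of_ne_of_ne hqp hqp'
    -- The transposition `(p q)` is the conjugate of `(p' q)` by the adjacent transposition `σ`. The
    -- two factors `σ` change the inversion count by opposite signs unless `u p'` lies strictly
    -- between `u p` and `u q`, in which case both add one.
    have hprod : u * Equiv.swap p q = u * σ * Equiv.swap p' q * σ := by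
      have := Equiv.mul_swap_eq_swap_mul σ p' q
      rw [hσq, hσ, Equiv.swap_apply_right, ← hσ] at this
      rw [mul_assoc u, this, mul_assoc, mul_assoc, hσ, Equiv.swap_mul_self, mul_one]
    have hu'p' : (u * σ) p' = u p := by simp [hσ]
    have hu'q : (u * σ) q = u q := by simp [hσq]
    obtain ⟨ih1, ih2⟩ := ih (u * σ) p' (by omega) (by rwa [hu'p', hu'q])
    have hvp : (u * σ * Equiv.swap p' q) p = u p' := by
      simp [Equiv.swap_apply_of_ne_of_ne hpp' hqp.symm, hσ]
    have hvp' : (u * σ * Equiv.swap p' q) p' = u q := by simp [hσq]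
    rw [hprod]
    have ih2' : (∀ s, p < s → s < q → u p < u s → ¬ u s < u q) →
        (permInversions (u * σ * Equiv.swap p' q)).card = (permInversions (u * σ)).card + 1 := by
      intro hs
      refine ih2 fun s h1 h2 => ?_
      have hsp : s ≠ p := by rw [Ne, Fin.ext_iff]; rw [Fin.lt_def] at h1; omega
      have : (u * σ) s = u s := by
        simp [hσ, Equiv.swap_apply_of_ne_of_ne hsp h1.ne']
      rw [hu'p', hu'q, this]
      exact hs s (by rw [Fin.lt_def] at *; omega) h2
    have hp'mid : (∀ s, p < s → s < q → u p < u s → ¬ u s < u q) → u p < u p' → ¬ u p' < u q :=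
      fun hs => hs p' (by rw [Fin.lt_def]; omega) (by rw [Fin.lt_def]; omega)
    rcases lt_or_gt_of_ne (u.injective.ne hpp') with h1 | h1 <;>
    rcases lt_or_gt_of_ne (u.injective.ne hqp') with h2 | h2
    · have e1 := card_permInversions_mul_adjacent u hp' h1
      have e2 := card_permInversions_mul_adjacent' (u * σ * Equiv.swap p' q) hp'
        (by rwa [hvp, hvp'])
      rw [← hσ] at e1 e2
      exact ⟨by omega, fun hs => by have := ih2' hs; omega⟩
    · have e1 := card_permInversions_mul_adjacent u hp' h1
      have e2 := card_permInversions_mul_adjacent (u * σ * Equiv.swap p' q) hp'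
        (by rwa [hvp, hvp'])
      rw [← hσ] at e1 e2
      exact ⟨by omega, fun hs => absurd h2 (hp'mid hs h1)⟩
    · exact absurd (h1.trans h) h2.not_gt
    · have e1 := card_permInversions_mul_adjacent' u hp' h1
      have e2 := card_permInversions_mul_adjacent (u * σ * Equiv.swap p' q) hp'
        (by rwa [hvp, hvp'])
      rw [← hσ] at e1 e2
      exact ⟨by omega, fun hs => by have := ih2' hs; omega⟩

theorem permLength_lt_mul_swap {n : ℕ} {u : Equiv.Perm (Fin n)} {p q : Fin n} (hpq : p < q)
    (h : u p < u q) : permLength u < permLength (u * Equiv.swap p q) := by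
  rw [permLength_eq_card_permInversions, permLength_eq_card_permInversions]
  exact (card_permInversions_mul_swap (q - p - 1) u p q
    (by rw [Fin.lt_def] at hpq; omega) h).1

theorem permLength_mul_swap_of_empty {n : ℕ} {u : Equiv.Perm (Fin n)} {p q : Fin n} (hpq : p < q)
    (h : u p < u q) (hs : ∀ s, p < s → s < q → u p < u s → ¬ u s < u q) :
    permLength (u * Equiv.swap p q) = permLength u + 1 := by
  rw [permLength_eq_card_permInversions, permLength_eq_card_permInversions]
  exact (card_permInversions_mul_swap (q - p - 1) u p q
    (by rw [Fin.lt_def] at hpq; omega) h).2 hs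

/-! ### The rank-matrix criterion for the Bruhat order -/

/-- The number of points of the permutation diagram of `v` in the first `k` columns and
in the rows from `a` on. -/
def permRank {n : ℕ} (v : Equiv.Perm (Fin n)) (k a : ℕ) : ℕ :=
  (Finset.univ.filter fun x : Fin n => (x : ℕ) < k ∧ a ≤ v x).card

theorem permRank_eq_sum {n : ℕ} (v : Equiv.Perm (Fin n)) (k a : ℕ) :
    permRank v k a = ∑ x : Fin n, if (x : ℕ) < k ∧ a ≤ v x then 1 else 0 :=
  Finset.card_filter _ _

theorem permRank_succ {n : ℕ} (v : Equiv.Perm (Fin n)) (m : Fin n) (a : ℕ) :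
    permRank v (m + 1) a = permRank v m a + if a ≤ v m then 1 else 0 := by
  have h1 : ∀ x ∈ Finset.univ.erase m, (if (x : ℕ) < m + 1 ∧ a ≤ v x then 1 else 0)
      = if (x : ℕ) < m ∧ a ≤ v x then 1 else 0 := by
    intro x hx
    have : (x : ℕ) ≠ m := fun h => (Finset.ne_of_mem_erase hx) (Fin.ext h)
    congr 1
    apply propext
    constructor <;> rintro ⟨h, h'⟩ <;> exact ⟨by omega, h'⟩
  rw [permRank_eq_sum, permRank_eq_sum, ← Finset.add_sum_erase _ _ (Finset.mem_univ m),
    ← Finset.add_sum_erase (a := m) Finset.univ _ (Finset.mem_univ m), Finset.sum_congr rfl h1]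
  simp
  omega

theorem permRank_mul_swap {n : ℕ} (u : Equiv.Perm (Fin n)) {p q : Fin n} (hpq : p ≠ q) (k a : ℕ) :
    permRank (u * Equiv.swap p q) k a + (if (p : ℕ) < k ∧ a ≤ u p then 1 else 0)
        + (if (q : ℕ) < k ∧ a ≤ u q then 1 else 0)
      = permRank u k a + (if (p : ℕ) < k ∧ a ≤ u q then 1 else 0)
        + (if (q : ℕ) < k ∧ a ≤ u p then 1 else 0) := by
  have hq : q ∈ Finset.univ.erase p := Finset.mem_erase.2 ⟨hpq.symm, Finset.mem_univ q⟩
  have h1 : ∀ x ∈ (Finset.univ.erase p).erase q,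
      (if (x : ℕ) < k ∧ a ≤ (u * Equiv.swap p q) x then 1 else 0)
        = if (x : ℕ) < k ∧ a ≤ u x then 1 else 0 := by
    intro x hx
    obtain ⟨hxq, hx⟩ := Finset.mem_erase.1 hx
    obtain ⟨hxp, hx⟩ := Finset.mem_erase.1 hx
    rw [Equiv.Perm.mul_apply, Equiv.swap_apply_of_ne_of_ne hxp hxq]
  rw [permRank_eq_sum, permRank_eq_sum, ← Finset.add_sum_erase _ _ (Finset.mem_univ p),
    ← Finset.add_sum_erase _ _ hq, Finset.sum_congr rfl h1,
    ← Finset.add_sum_erase (a := p) Finset.univ _ (Finset.mem_univ p),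
    ← Finset.add_sum_erase (Finset.univ.erase p) _ hq]
  simp only [Equiv.Perm.mul_apply, Equiv.swap_apply_left, Equiv.swap_apply_right]
  omega

theorem permRank_mul_swap_of_lt {n : ℕ} (u : Equiv.Perm (Fin n)) {p q : Fin n} (hpq : p < q)
    (h : u p < u q) (k a : ℕ) :
    permRank (u * Equiv.swap p q) k a
      = permRank u k a + if ((p : ℕ) < k ∧ k ≤ q) ∧ ((u p : ℕ) < a ∧ a ≤ u q) then 1 else 0 := by
  have := permRank_mul_swap u hpq.ne k a
  rw [Fin.lt_def] at hpq h
  split_ifs at * <;> omega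

/-- Comparison of the rank matrices of two permutations. -/
def RankLE {n : ℕ} (u w : Equiv.Perm (Fin n)) : Prop :=
  ∀ k a, permRank u k a ≤ permRank w k a

/-- Right multiplication of `u` by the transposition of `p < q` stays below `w`. -/
def RankArc {n : ℕ} (w u : Equiv.Perm (Fin n)) (p q : Fin n) : Prop :=
  p < q ∧ ∀ k a : ℕ, (p : ℕ) < k → k ≤ q → (u p : ℕ) < a → a ≤ u q →
    permRank u k a < permRank w k a

theorem rankArc_of_gt {n : ℕ} (w : Equiv.Perm (Fin n)) {u : Equiv.Perm (Fin n)} {p q : Fin n}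
    (hpq : p < q) (h : u q < u p) : RankArc w u p q :=
  ⟨hpq, fun k a _ _ h1 h2 => by rw [Fin.lt_def] at h; omega⟩

theorem rankLE_mul_swap_iff {n : ℕ} {u w : Equiv.Perm (Fin n)} (hu : RankLE u w) {p q : Fin n}
    (hpq : p < q) : RankLE (u * Equiv.swap p q) w ↔ RankArc w u p q := by
  rcases lt_or_gt_of_ne (u.injective.ne hpq.ne) with h | h
  · constructor
    · refine fun h' => ⟨hpq, fun k a h1 h2 h3 h4 => ?_⟩
      have := h' k a
      rw [permRank_mul_swap_of_lt u hpq h, if_pos ⟨⟨h1, h2⟩, h3, h4⟩] at this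
      omega
    · intro h' k a
      rw [permRank_mul_swap_of_lt u hpq h]
      split_ifs with hc
      · exact h'.2 k a hc.1.1 hc.1.2 hc.2.1 hc.2.2
      · exact hu k a
  · refine iff_of_true (fun k a => ?_) (rankArc_of_gt w hpq h)
    have := permRank_mul_swap_of_lt (u * Equiv.swap p q) hpq (by simpa using h) k a
    rw [mul_assoc, Equiv.swap_mul_self, mul_one] at this
    have := hu k a
    omega

theorem RankLE.of_bruhatLE {n : ℕ} {u w : Equiv.Perm (Fin n)} (h : BruhatLE u w) :
    RankLE u w := by
  induction h with
  | refl => exact fun _ _ => le_rfl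
  | @tail v w _ hvw ih =>
    obtain ⟨t, ⟨p, q, hpq, rfl⟩, rfl, hl⟩ := hvw
    wlog hlt : p < q generalizing p q
    · rw [Equiv.swap_comm] at hl ⊢
      exact this q p hpq.symm hl (lt_of_le_of_ne (not_lt.1 hlt) hpq.symm)
    have hv : v p < v q := by
      refine lt_of_le_of_ne (not_lt.1 fun hcon => ?_) (v.injective.ne hpq)
      have := permLength_lt_mul_swap (u := v * Equiv.swap p q) hlt (by simpa using hcon)
      rw [mul_assoc, Equiv.swap_mul_self, mul_one] at this
      omega
    intro k a
    refine (ih k a).trans ?_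
    rw [permRank_mul_swap_of_lt v hlt hv]
    omega

/-- Take `p` to be the first position where `u` and `w` differ, so that `u p < w p`, and `q` the
first later position with value in `(u p, w p]`. This choice makes the rectangle from `p` to `q`
empty. -/
theorem RankLE.eq_or_exists_arc {n : ℕ} {u w : Equiv.Perm (Fin n)} (h : RankLE u w) :
    u = w ∨ ∃ p q, RankArc w u p q ∧ u p < u q ∧
      ∀ s, p < s → s < q → u p < u s → ¬ u s < u q := by
  classical
  by_cases huw : u = w
  · exact Or.inl huw
  right
  have hne : (Finset.univ.filter fun x => u x ≠ w x).Nonempty := by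
    by_contra hcon
    rw [Finset.not_nonempty_iff_eq_empty, Finset.filter_eq_empty_iff] at hcon
    exact huw (Equiv.ext fun x => by simpa using hcon (Finset.mem_univ x))
  obtain ⟨p, hp, hpmin⟩ := Finset.exists_min_image _ id hne
  simp only [Finset.mem_filter, Finset.mem_univ, true_and, id] at hp hpmin
  have hagree : ∀ x, x < p → u x = w x := fun x hx => by
    by_contra hcon
    exact (hpmin x hcon).not_gt hx
  have hup : u p < w p := by
    refine lt_of_le_of_ne ?_ hp
    by_contra hcon
    have h1 := h (p + 1) (u p)
    have h2 : permRank u p (u p) = permRank w p (u p) := by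
      unfold permRank
      congr 1
      ext x
      simp only [Finset.mem_filter, Finset.mem_univ, true_and]
      refine and_congr_right fun hx => ?_
      rw [hagree x hx]
    rw [permRank_succ, permRank_succ, h2, if_pos le_rfl, if_neg (by simpa using hcon)] at h1
    omega
  have hne' : (Finset.univ.filter fun x => p < x ∧ u p < u x ∧ u x ≤ w p).Nonempty := by
    refine ⟨u.symm (w p), ?_⟩
    simp only [Finset.mem_filter, Finset.mem_univ, true_and, Equiv.apply_symm_apply, le_refl,
      and_true, hup]
    rcases lt_trichotomy (u.symm (w p)) p with h' | h' | h'
    · have := hagree _ h'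
      rw [Equiv.apply_symm_apply] at this
      exact absurd (w.injective this).symm h'.ne
    · rw [← h', Equiv.apply_symm_apply, h'] at hup
      exact absurd hup (lt_irrefl _)
    · exact h'
  obtain ⟨q, hq, hqmin⟩ := Finset.exists_min_image _ id hne'
  simp only [Finset.mem_filter, Finset.mem_univ, true_and, id] at hq hqmin
  obtain ⟨hpq, huq, huw'⟩ := hq
  refine ⟨p, q, ⟨hpq, fun k a h1 h2 h3 h4 => ?_⟩, huq, fun s h1 h2 h3 h4 =>
    (hqmin s ⟨h1, h3, h4.le.trans huw'⟩).not_gt h2⟩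
  rw [Fin.lt_def] at hup
  rw [Fin.le_def] at huw'
  -- Split the rows at `w p`. Above it the hypothesis gives a weak inequality. In the rows from `a`
  -- to `w p`, the points of `u` before column `k` lie left of `p`, hence are points of `w`, which
  -- has the additional point at `p`.
  have e : ∀ v : Equiv.Perm (Fin n), permRank v k a = permRank v k (w p + 1) +
      (Finset.univ.filter fun x : Fin n => (x : ℕ) < k ∧ a ≤ v x ∧ (v x : ℕ) < w p + 1).card := by
    intro v
    unfold permRank
    rw [← Finset.card_union_of_disjoint]
    · congr 1
      ext x
      simp only [Finset.mem_filter, Finset.mem_univ, true_and, Finset.mem_union]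
      omega
    · rw [Finset.disjoint_left]
      intro x
      simp only [Finset.mem_filter, Finset.mem_univ, true_and]
      omega
  rw [e u, e w]
  refine add_lt_add_of_le_of_lt (h k _) (Finset.card_lt_card ?_)
  refine (Finset.ssubset_iff_of_subset fun x hx => ?_).2 ⟨p, ?_, ?_⟩
  · simp only [Finset.mem_filter, Finset.mem_univ, true_and] at hx ⊢
    rcases lt_trichotomy x p with h' | h' | h'
    · rwa [← hagree x h']
    · rw [h'] at hx
      omega
    · have := hqmin x ⟨h', by rw [Fin.lt_def]; omega, by rw [Fin.le_def]; omega⟩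
      rw [Fin.le_def] at this
      omega
  · simp only [Finset.mem_filter, Finset.mem_univ, true_and]
    omega
  · simp only [Finset.mem_filter, Finset.mem_univ, true_and]
    omega

theorem RankLE.bruhatLE {n : ℕ} {u w : Equiv.Perm (Fin n)} (h : RankLE u w) :
    BruhatLE u w := by
  -- Each cover found above raises the length, which `n * n` bounds as a count of pairs.
  obtain ⟨d, hd⟩ : ∃ d, n * n - permLength u = d := ⟨_, rfl⟩
  induction d using Nat.strong_induction_on generalizing u with
  | _ d ih =>
    rcases h.eq_or_exists_arc with rfl | ⟨p, q, harc, hu, hempty⟩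
    · exact Relation.ReflTransGen.refl
    · have hl := permLength_mul_swap_of_empty harc.1 hu hempty
      have hb : permLength (u * Equiv.swap p q) ≤ n * n := by
        rw [permLength_eq_card_permInversions]
        exact (Finset.card_le_univ _).trans (by simp)
      exact (ih _ (by omega) ((rankLE_mul_swap_iff h harc.1).2 harc) rfl).head
        ⟨_, ⟨p, q, harc.1.ne, rfl⟩, rfl, hl⟩

/-! ### Heights for non-crossing systems of arcs -/

/-- A chain-start argument: in a finite set of points `(x, u x)` with a non-crossing system of
increasing arcs, some nonempty union of arc components has no point to the north-west of it. -/
theorem exists_source_component {α β : Type*} [LinearOrder α] [LinearOrder β] (u : α → β)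
    (hu : Function.Injective u) (U : α → α → Prop)
    (hlt : ∀ a b, U a b → a < b ∧ u a < u b)
    (hrect : ∀ a b s, U a b → a < s → s < b → u a < u s → ¬ u s < u b)
    (hout : ∀ a b c, U a b → U a c → b = c) (hin : ∀ a b c, U a c → U b c → a = b)
    (hcross : ∀ a b c d, U a b → U d c → a < d → u d < u a → c < b → ¬ u b < u c)
    (X : Finset α) (hX : ∀ a b, U a b → (a ∈ X ↔ b ∈ X)) (hne : X.Nonempty) :
    ∃ C : Set α, (∃ x ∈ X, x ∈ C) ∧ (∀ a b, U a b → (a ∈ C ↔ b ∈ C)) ∧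
      ∀ c ∈ C, ∀ x ∈ X, x < c → ¬ u c < u x := by
  classical
  -- The left-to-right maxima of `X` at which no arc ends. The component is the path that starts at
  -- the rightmost of them.
  let T : Finset α := X.filter fun x =>
    (∀ y ∈ X, y < x → ¬ u x < u y) ∧ ∀ y, ¬ U y x
  have hT : T.Nonempty := by
    refine ⟨X.min' hne, Finset.mem_filter.2 ⟨X.min'_mem hne, fun y hy h => ?_, fun y hy => ?_⟩⟩
    · exact absurd (X.min'_le y hy) h.not_ge
    · exact absurd (X.min'_le y ((hX _ _ hy).2 (X.min'_mem hne))) (hlt _ _ hy).1.not_ge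
  set x := T.max' hT with hx
  obtain ⟨hxX, hx1, hx2⟩ := Finset.mem_filter.1 (T.max'_mem hT)
  rw [← hx] at hxX hx1 hx2
  have hCX : ∀ y, Relation.ReflTransGen U x y →
      x ≤ y ∧ y ∈ X ∧ ∀ z ∈ X, z < y → ¬ u y < u z := by
    intro y hy
    induction hy with
    | refl => exact ⟨le_rfl, hxX, hx1⟩
    | @tail a b _ hab ih =>
      obtain ⟨hxa, haX, ha⟩ := ih
      have hbX := (hX _ _ hab).1 haX
      obtain ⟨hab1, hab2⟩ := hlt _ _ hab
      refine ⟨hxa.trans hab1.le, hbX, fun z hz hzb hzu => ?_⟩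
      -- If `z` were north-west of `b`, the leftmost point `c` to the north-east of `a` would be a
      -- left-to-right maximum. An arc ending at `c` would violate one of the hypotheses, so `c`
      -- would be in `T` and to the right of `x`.
      have hne : (X.filter fun y => a < y ∧ u a < u y).Nonempty := by
        refine ⟨z, Finset.mem_filter.2 ⟨hz, ?_, hab2.trans hzu⟩⟩
        rcases lt_trichotomy z a with h | h | h
        · exact absurd (hab2.trans hzu) (ha z hz h)
        · rw [h] at hzu
          exact absurd hab2 hzu.not_gt
        · exact h
      obtain ⟨c, hc, hcmin⟩ := Finset.exists_min_image _ id hne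
      simp only [Finset.mem_filter, id] at hc hcmin
      obtain ⟨hcX, hac, huac⟩ := hc
      have hcb : c < b := by
        refine lt_of_le_of_lt (hcmin z ⟨hz, ?_, hab2.trans hzu⟩) hzb
        rcases lt_trichotomy z a with h | h | h
        · exact absurd (hab2.trans hzu) (ha z hz h)
        · rw [h] at hzu
          exact absurd hab2 hzu.not_gt
        · exact h
      have hubc : u b < u c :=
        lt_of_le_of_ne (not_lt.1 (hrect a b c hab hac hcb huac)) (hu.ne hcb.ne')
      have hcT : c ∈ T := by
        refine Finset.mem_filter.2 ⟨hcX, fun y hy hyc huy => ?_, fun d hd => ?_⟩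
        · rcases lt_trichotomy y a with h | h | h
          · exact ha y hy h (huac.trans huy)
          · rw [h] at huy
            exact huac.not_gt huy
          · exact (hcmin y ⟨hy, h, huac.trans huy⟩).not_gt hyc
        · have hdX := (hX _ _ hd).2 hcX
          obtain ⟨hdc1, hdc2⟩ := hlt _ _ hd
          rcases lt_trichotomy d a with h | h | h
          · rcases lt_trichotomy (u d) (u a) with h' | h' | h'
            · exact hrect d c a hd h hac h' huac
            · exact h.ne (hu h')
            · exact ha d hdX h h'
          · rw [h] at hd
            exact hcb.ne (hout _ _ _ hd hab)
          · rcases lt_trichotomy (u d) (u a) with h' | h' | h'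
            · exact hcross a b c d hab hd h h' hcb hubc
            · exact h.ne' (hu h')
            · exact (hcmin d ⟨hdX, h, h'⟩).not_gt hdc1
      exact absurd (hxa.trans_lt hac) (not_lt.2 (T.le_max' c hcT))
  refine ⟨{y | Relation.ReflTransGen U x y}, ⟨x, hxX, Relation.ReflTransGen.refl⟩,
    fun a b hab => ⟨fun h => h.tail hab, fun h => ?_⟩, fun c hc => (hCX c hc).2.2⟩
  rcases Relation.ReflTransGen.cases_tail h with h | ⟨a', h1, h2⟩
  · rw [h] at hab
    exact absurd hab (hx2 a)
  · rwa [hin _ _ _ hab h2]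

/-- For a non-crossing system of increasing arcs there is a function which is constant along
the arcs and increases from north-west to south-east. -/
theorem exists_height {α β : Type*} [LinearOrder α] [LinearOrder β] [Fintype α] (u : α → β)
    (hu : Function.Injective u) (U : α → α → Prop)
    (hlt : ∀ a b, U a b → a < b ∧ u a < u b)
    (hrect : ∀ a b s, U a b → a < s → s < b → u a < u s → ¬ u s < u b)
    (hout : ∀ a b c, U a b → U a c → b = c) (hin : ∀ a b c, U a c → U b c → a = b)
    (hcross : ∀ a b c d, U a b → U d c → a < d → u d < u a → c < b → ¬ u b < u c) :
    ∃ f : α → ℕ, (∀ a b, U a b → f a = f b) ∧ ∀ a b, a < b → u b < u a → f a < f b := by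
  classical
  suffices h : ∀ X : Finset α, (∀ a b, U a b → (a ∈ X ↔ b ∈ X)) →
      ∃ f : α → ℕ, (∀ a ∈ X, ∀ b ∈ X, U a b → f a = f b) ∧
        ∀ a ∈ X, ∀ b ∈ X, a < b → u b < u a → f a < f b by
    obtain ⟨f, h1, h2⟩ := h Finset.univ (by simp)
    exact ⟨f, fun a b => h1 a (by simp) b (by simp), fun a b => h2 a (by simp) b (by simp)⟩
  intro X
  induction X using Finset.strongInduction with
  | H X ih =>
    intro hX
    rcases X.eq_empty_or_nonempty with rfl | hne
    · exact ⟨fun _ => 0, by simp, by simp⟩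
    obtain ⟨C, ⟨x, hxX, hxC⟩, hCU, hC⟩ :=
      exists_source_component u hu U hlt hrect hout hin hcross X hX hne
    obtain ⟨f, hf1, hf2⟩ := ih (X.filter (· ∉ C))
      (Finset.filter_ssubset.2 ⟨x, hxX, by simpa using hxC⟩)
      (fun a b hab => by rw [Finset.mem_filter, Finset.mem_filter, hX a b hab, hCU a b hab])
    -- The removed component gets the lowest height; nothing lies to its north-west.
    refine ⟨fun y => if y ∈ C then 0 else f y + 1, fun a ha b hb hab => ?_,
      fun a ha b hb h1 h2 => ?_⟩
    · have := hCU a b hab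
      by_cases hbC : b ∈ C
      · simp [hbC, this.2 hbC]
      · have haC : a ∉ C := fun h => hbC (this.1 h)
        simp only [haC, hbC, if_false]
        rw [hf1 a (by simp [ha, haC]) b (by simp [hb, hbC]) hab]
    · by_cases hbC : b ∈ C
      · exact absurd h2 (hC b hbC a ha h1)
      · by_cases haC : a ∈ C
        · simp [haC, hbC]
        · simp only [haC, hbC, if_false]
          have := hf2 a (by simp [ha, haC]) b (by simp [hb, hbC]) h1 h2
          omega

/-- In a forest of directed arcs with in-degree at most one, there is a function which is
constant along the arcs of a given subset and increases along the other arcs. -/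
theorem exists_arc_count {α : Type*} [Fintype α] (U E : α → α → Prop)
    (hac : ∀ a b, Relation.ReflTransGen U b a → ¬ U a b)
    (hin : ∀ a b c, U a c → U b c → a = b) :
    ∃ g : α → ℕ, (∀ a, g a ≤ Fintype.card α) ∧ ∀ a b, U a b →
      (E a b → g a = g b) ∧ (¬ E a b → g a < g b) := by
  classical
  -- The heads of the arcs outside `E` on the path leading to `x`.
  let A : α → Finset α := fun x => Finset.univ.filter fun b =>
    Relation.ReflTransGen U b x ∧ ∃ a, U a b ∧ ¬ E a b
  have hA : ∀ a b, U a b → ∀ x, x ∈ A b ↔ x ∈ A a ∨ (x = b ∧ ¬ E a b) := by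
    intro a b hab x
    simp only [A, Finset.mem_filter, Finset.mem_univ, true_and]
    constructor
    · rintro ⟨h1, a', h2, h3⟩
      rcases Relation.ReflTransGen.cases_tail h1 with h | ⟨c, hc1, hc2⟩
      · subst h
        rw [hin _ _ _ hab h2]
        exact Or.inr ⟨rfl, h3⟩
      · rw [hin _ _ _ hab hc2]
        exact Or.inl ⟨hc1, a', h2, h3⟩
    · rintro (⟨h1, h2⟩ | ⟨rfl, h⟩)
      · exact ⟨h1.tail hab, h2⟩
      · exact ⟨Relation.ReflTransGen.refl, a, hab, h⟩
  refine ⟨fun x => (A x).card, fun a => Finset.card_le_univ _, fun a b hab =>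
    ⟨fun h => ?_, fun h => ?_⟩⟩
  · refine congrArg Finset.card (Finset.ext fun x => ?_)
    rw [hA a b hab]
    simp [h]
  · apply Finset.card_lt_card
    refine (Finset.ssubset_iff_of_subset fun x hx => (hA a b hab x).2 (Or.inl hx)).2
      ⟨b, (hA a b hab b).2 (Or.inr ⟨rfl, h⟩), fun hb => ?_⟩
    exact hac a b (Finset.mem_filter.1 hb).2.1 hab

/-! ### Generators of the tangent cone -/

/-- The exchange condition for `p` and `q` in the single column `k` of the rank matrix. -/
def ColumnArc {n : ℕ} (w u : Equiv.Perm (Fin n)) (k : ℕ) (p q : Fin n) : Prop :=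
  (p : ℕ) < k ∧ k ≤ q ∧ ∀ a : ℕ, (u p : ℕ) < a → a ≤ u q → permRank u k a < permRank w k a

/-- From column `m` to `m + 1` the slack `permRank w - permRank u` in row `a` changes by `[a ≤ w m]
- [a ≤ u m]`. A slack vanishing at `a0` in only one of the two columns places `a0` between `u m` and
`w m`, and this makes the slack positive on the rows needed for both halves. -/
theorem ColumnArc.split {n : ℕ} {w u : Equiv.Perm (Fin n)} (hu : RankLE u w) {m p q : Fin n}
    (hpm : p < m) (hmq : m < q)
    (h : ¬ (ColumnArc w u m p q ↔ ColumnArc w u (m + 1) p q)) :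
    ColumnArc w u m p m ∧ ColumnArc w u (m + 1) m q := by
  rw [Fin.lt_def] at hpm hmq
  suffices h' : ∃ a0 : ℕ, (u p : ℕ) < a0 ∧ a0 ≤ u q ∧
      ((∀ a : ℕ, (u p : ℕ) < a → a ≤ u q → permRank u m a < permRank w m a) ∧
          permRank u (m + 1) a0 = permRank w (m + 1) a0 ∨
        (∀ a : ℕ, (u p : ℕ) < a → a ≤ u q → permRank u (m + 1) a < permRank w (m + 1) a) ∧
          permRank u m a0 = permRank w m a0) by
    obtain ⟨a0, h1, h2, h3⟩ := h'
    have e0u := permRank_succ u m a0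
    have e0w := permRank_succ w m a0
    refine ⟨⟨hpm, le_rfl, fun a ha1 ha2 => ?_⟩, ⟨by omega, hmq, fun a ha1 ha2 => ?_⟩⟩
    all_goals
      have eu := permRank_succ u m a
      have ew := permRank_succ w m a
      have l1 := hu m a
      have l2 := hu (m + 1) a
      rcases h3 with ⟨h3, h4⟩ | ⟨h3, h4⟩
      all_goals
        have h5 := h3 a
        have h6 := h3 a0 h1 h2
        split_ifs at * <;> omega
  by_cases hm : ColumnArc w u m p q
  · have hm' : ¬ ColumnArc w u (m + 1) p q := fun h' => h (iff_of_true hm h')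
    have : ∃ a0 : ℕ, (u p : ℕ) < a0 ∧ a0 ≤ u q ∧
        ¬ permRank u (m + 1) a0 < permRank w (m + 1) a0 := by
      by_contra! hcon
      exact hm' ⟨by omega, hmq, hcon⟩
    obtain ⟨a0, h1, h2, h3⟩ := this
    exact ⟨a0, h1, h2, Or.inl ⟨hm.2.2, le_antisymm (hu _ _) (not_lt.1 h3)⟩⟩
  · have hm' : ColumnArc w u (m + 1) p q := by
      by_contra h'
      exact h (iff_of_false hm h')
    have : ∃ a0 : ℕ, (u p : ℕ) < a0 ∧ a0 ≤ u q ∧ ¬ permRank u m a0 < permRank w m a0 := by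
      by_contra! hcon
      exact hm ⟨hpm, hmq.le, hcon⟩
    obtain ⟨a0, h1, h2, h3⟩ := this
    exact ⟨a0, h1, h2, Or.inr ⟨hm'.2.2, le_antisymm (hu _ _) (not_lt.1 h3)⟩⟩

/-- If no intermediate column changes the status of the exchange, it holds in all columns and is an
arc. Otherwise it splits at that column into two shorter exchanges. -/
theorem ColumnArc.transGen {n : ℕ} {w u : Equiv.Perm (Fin n)} (hu : RankLE u w) {k : ℕ}
    {p q : Fin n} (h : ColumnArc w u k p q) : Relation.TransGen (RankArc w u) p q := by
  obtain ⟨d, hd⟩ : ∃ d, (q : ℕ) - p = d := ⟨_, rfl⟩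
  induction d using Nat.strong_induction_on generalizing k p q with
  | _ d ih =>
    have hpq : (p : ℕ) < q := h.1.trans_le h.2.1
    by_cases hall : ∀ m : Fin n, p < m → m < q →
        (ColumnArc w u m p q ↔ ColumnArc w u (m + 1) p q)
    · have hfirst : ∀ j : ℕ, (p : ℕ) + 1 + j ≤ q →
          (ColumnArc w u (p + 1) p q ↔ ColumnArc w u (p + 1 + j) p q) := by
        intro j
        induction j with
        | zero => exact fun _ => Iff.rfl
        | succ j ihj =>
          intro hj
          rw [ihj (by omega)]
          exact hall ⟨p + 1 + j, by omega⟩ (Fin.lt_def.2 (by simp only; omega))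
            (Fin.lt_def.2 (by simp only; omega))
      refine Relation.TransGen.single ⟨Fin.lt_def.2 hpq, fun k' a h1 h2 h3 h4 => ?_⟩
      have hk := h.1
      have hk' := h.2.1
      have e1 := hfirst (k - (p + 1)) (by omega)
      have e2 := hfirst (k' - (p + 1)) (by omega)
      rw [show (p : ℕ) + 1 + (k - (p + 1)) = k by omega] at e1
      rw [show (p : ℕ) + 1 + (k' - (p + 1)) = k' by omega] at e2
      exact (e2.1 (e1.2 h)).2.2 a h3 h4
    · push Not at hall
      obtain ⟨m, hpm, hmq, hm⟩ := hall
      obtain ⟨h1, h2⟩ := ColumnArc.split hu hpm hmq (by tauto)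
      rw [Fin.lt_def] at hpm hmq
      exact (ih (m - p) (by omega) h1 rfl).trans (ih (q - m) (by omega) h2 rfl)

/-- The difference of the indicator vectors of two sets below a common Gale bound is a sum of
vectors of elementary exchanges at the first set. -/
theorem sum_single_sub_sum_single_mem {n : ℕ} (W : ℕ → ℕ) (G : AddSubmonoid (Fin n → ℝ))
    (B : Finset (Fin n)) (hB : ∀ a : ℕ, (B.filter fun x : Fin n => a ≤ (x : ℕ)).card ≤ W a)
    (hG : ∀ i ∈ B, ∀ j, j ∉ B →
      (∀ a : ℕ, (i : ℕ) < a → a ≤ j → (B.filter fun x : Fin n => a ≤ (x : ℕ)).card < W a) →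
      (Pi.single i 1 - Pi.single j 1 : Fin n → ℝ) ∈ G)
    (B' : Finset (Fin n)) (hcard : B'.card = B.card)
    (hB' : ∀ a : ℕ, (B'.filter fun x : Fin n => a ≤ (x : ℕ)).card ≤ W a) :
    (∑ x ∈ B, Pi.single x 1 - ∑ x ∈ B', Pi.single x 1 : Fin n → ℝ) ∈ G := by
  obtain ⟨d, hd⟩ : ∃ d, (B' \ B).card = d := ⟨_, rfl⟩
  induction d generalizing B' with
  | zero =>
    rw [Finset.card_eq_zero, Finset.sdiff_eq_empty_iff_subset] at hd
    rw [Finset.eq_of_subset_of_card_le hd hcard.ge, sub_self]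
    exact G.zero_mem
  | succ d ih =>
    have hne' : (B' \ B).Nonempty := Finset.card_pos.1 (by omega)
    have hne : (B \ B').Nonempty := by
      rw [← Finset.card_pos, Finset.card_sdiff_comm hcard.symm]
      omega
    -- With both elements maximal, `B` and `B'` agree above `i` and `j`. Thus exchanging `i` for `j`
    -- is allowed at `B`, and replacing `j` by `i` in `B'` keeps the Gale bound while bringing `B'`
    -- closer to `B`.
    obtain ⟨i, hi, himax⟩ := Finset.exists_max_image _ id hne
    obtain ⟨j, hj, hjmax⟩ := Finset.exists_max_image _ id hne'
    obtain ⟨hiB, hiB'⟩ := Finset.mem_sdiff.1 hi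
    obtain ⟨hjB', hjB⟩ := Finset.mem_sdiff.1 hj
    have himax' : ∀ x, x ∈ B → (i : ℕ) < x → x ∈ B' := by
      intro x hx hlt
      by_contra hcon
      exact absurd (himax x (Finset.mem_sdiff.2 ⟨hx, hcon⟩)) (not_le.2 (Fin.lt_def.2 hlt))
    have hjmax' : ∀ x, x ∈ B' → (j : ℕ) < x → x ∈ B := by
      intro x hx hlt
      by_contra hcon
      exact absurd (hjmax x (Finset.mem_sdiff.2 ⟨hx, hcon⟩)) (not_le.2 (Fin.lt_def.2 hlt))
    set B'' := insert i (B'.erase j) with hB''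
    have hi'' : i ∉ B'.erase j := fun h => hiB' (Finset.mem_of_mem_erase h)
    have hij : i ≠ j := fun h => hjB (h ▸ hiB)
    have hstep : (Pi.single i 1 - Pi.single j 1 : Fin n → ℝ) ∈ G := by
      refine hG i hiB j hjB fun a h1 h2 => lt_of_lt_of_le (Finset.card_lt_card ?_) (hB' a)
      refine (Finset.ssubset_iff_of_subset fun x hx => ?_).2 ⟨j, by simp [hjB', h2], by simp [hjB]⟩
      rw [Finset.mem_filter] at hx ⊢
      exact ⟨himax' x hx.1 (by omega), hx.2⟩
    have hmem := ih B'' ?_ ?_ ?_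
    · have hsum : (∑ x ∈ B'', Pi.single x 1 : Fin n → ℝ)
          = Pi.single i 1 + (∑ x ∈ B', Pi.single x 1 - Pi.single j 1) := by
        rw [hB'', Finset.sum_insert hi'', ← Finset.add_sum_erase B' _ hjB', add_sub_cancel_left]
      have := G.add_mem hmem hstep
      rw [hsum] at this
      convert this using 1
      abel
    · rw [hB'', Finset.card_insert_of_notMem hi'', Finset.card_erase_of_mem hjB']
      have : 0 < B'.card := Finset.card_pos.2 ⟨j, hjB'⟩
      omega
    · intro a
      by_cases ha1 : a ≤ j
      · refine le_trans ?_ (hB' a)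
        have hsub : (B''.filter fun x : Fin n => a ≤ (x : ℕ))
            ⊆ insert i ((B'.filter fun x : Fin n => a ≤ (x : ℕ)).erase j) := by
          intro x hx
          simp only [hB'', Finset.mem_filter, Finset.mem_insert, Finset.mem_erase] at hx ⊢
          tauto
        refine (Finset.card_le_card hsub).trans ((Finset.card_insert_le _ _).trans ?_)
        rw [Finset.card_erase_add_one (Finset.mem_filter.2 ⟨hjB', ha1⟩)]
      · by_cases ha2 : a ≤ i
        · refine (Finset.card_le_card fun x hx => ?_).trans (hB a)
          simp only [hB'', Finset.mem_filter, Finset.mem_insert, Finset.mem_erase] at hx ⊢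
          rcases hx with ⟨rfl | ⟨hx1, hx2⟩, hx3⟩
          · exact ⟨hiB, hx3⟩
          · exact ⟨hjmax' x hx2 (by omega), hx3⟩
        · refine (Finset.card_le_card fun x hx => ?_).trans (hB' a)
          simp only [hB'', Finset.mem_filter, Finset.mem_insert, Finset.mem_erase] at hx ⊢
          rcases hx with ⟨rfl | ⟨hx1, hx2⟩, hx3⟩
          · omega
          · exact ⟨hx2, hx3⟩
    · have : B'' \ B = (B' \ B).erase j := by
        ext x
        simp only [hB'', Finset.mem_sdiff, Finset.mem_insert, Finset.mem_erase]
        constructor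
        · rintro ⟨rfl | h, h'⟩
          · exact absurd hiB h'
          · exact ⟨h.1, h.2, h'⟩
        · exact fun h => ⟨Or.inr ⟨h.1, h.2.1⟩, h.2.2⟩
      rw [this, Finset.card_erase_of_mem hj]
      omega

/-- The values of `v` in the first `k` positions. -/
def permPrefix {n : ℕ} (v : Equiv.Perm (Fin n)) (k : ℕ) : Finset (Fin n) :=
  (Finset.univ.filter fun x : Fin n => (x : ℕ) < k).map v.toEmbedding

theorem mem_permPrefix {n : ℕ} {v : Equiv.Perm (Fin n)} {k : ℕ} {y : Fin n} :
    y ∈ permPrefix v k ↔ ((v⁻¹ y : Fin n) : ℕ) < k := by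
  simp [permPrefix, Finset.mem_map_equiv]

theorem card_filter_permPrefix {n : ℕ} (v : Equiv.Perm (Fin n)) (k a : ℕ) :
    ((permPrefix v k).filter fun x : Fin n => a ≤ (x : ℕ)).card = permRank v k a := by
  rw [permPrefix, Finset.filter_map, Finset.card_map, Finset.filter_filter, permRank]
  rfl

/-- The value `y` belongs to the prefixes of lengths `v⁻¹ y + 1, …, n`, which are `n - v⁻¹ y` in
number. -/
theorem permVec_eq_sum {n : ℕ} (v : Equiv.Perm (Fin n)) :
    permVec v = (fun _ => (n : ℝ) + 1)
      - ∑ k ∈ Finset.range (n + 1), ∑ x ∈ permPrefix v k, Pi.single x (1 : ℝ) := by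
  ext y
  have h1 : ∀ k, (∑ x ∈ permPrefix v k, Pi.single x (1 : ℝ) : Fin n → ℝ) y
      = if ((v⁻¹ y : Fin n) : ℕ) < k then 1 else 0 := by
    intro k
    rw [Finset.sum_apply]
    simp only [Pi.single_apply]
    rw [Finset.sum_ite_eq]
    simp only [mem_permPrefix]
  simp only [Pi.sub_apply, Finset.sum_apply (a := y) (s := Finset.range (n + 1)), h1]
  rw [Finset.sum_boole]
  have h2 : (Finset.range (n + 1)).filter (fun k => ((v⁻¹ y : Fin n) : ℕ) < k)
      = Finset.Ico ((v⁻¹ y : Fin n) + 1 : ℕ) (n + 1) := by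
    ext k
    simp only [Finset.mem_filter, Finset.mem_range, Finset.mem_Ico]
    omega
  have h3 := (v⁻¹ y).isLt
  rw [h2, Nat.card_Ico, permVec, Nat.cast_sub (by omega)]
  push_cast
  ring

/-- The tangent cone of the Bruhat interval polytope at `u` is generated by the directions of
the transpositions that stay below `w`. -/
theorem permVec_sub_permVec_mem_closure {n : ℕ} {u v w : Equiv.Perm (Fin n)} (hu : RankLE u w)
    (hv : RankLE v w) :
    permVec v - permVec u ∈ AddSubmonoid.closure
      {x : Fin n → ℝ | ∃ p q, RankArc w u p q ∧ x = Pi.single (u p) 1 - Pi.single (u q) 1} := by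
  set G := AddSubmonoid.closure
      {x : Fin n → ℝ | ∃ p q, RankArc w u p q ∧ x = Pi.single (u p) 1 - Pi.single (u q) 1} with hG
  have hpath : ∀ p q, Relation.TransGen (RankArc w u) p q →
      (Pi.single (u p) 1 - Pi.single (u q) 1 : Fin n → ℝ) ∈ G := by
    intro p q h
    induction h with
    | single h => exact AddSubmonoid.subset_closure ⟨_, _, h, rfl⟩
    | tail _ h ih =>
      have := G.add_mem ih (AddSubmonoid.subset_closure ⟨_, _, h, rfl⟩)
      rwa [sub_add_sub_cancel] at this
  rw [permVec_eq_sum, permVec_eq_sum, sub_sub_sub_cancel_left, ← Finset.sum_sub_distrib]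
  refine G.sum_mem fun k _ => ?_
  refine sum_single_sub_sum_single_mem (permRank w k) G _ (fun a => ?_) (fun i hi j hj hij => ?_) _
    ?_ (fun a => ?_)
  · rw [card_filter_permPrefix]
    exact hu k a
  · have hinv : ∀ y, u (u⁻¹ y) = y := u.apply_symm_apply
    rw [mem_permPrefix] at hi hj
    have hc : ColumnArc w u k (u⁻¹ i) (u⁻¹ j) := by
      refine ⟨hi, not_lt.1 hj, fun a h1 h2 => ?_⟩
      rw [hinv] at h1 h2
      rw [← card_filter_permPrefix]
      exact hij a h1 h2
    have := hpath _ _ (hc.transGen hu)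
    rwa [hinv, hinv] at this
  · rw [permPrefix, permPrefix, Finset.card_map, Finset.card_map]
  · rw [card_filter_permPrefix]
    exact hv k a

/-! ### Indecomposable arcs and their heights -/

/-- The transpositions below `w` whose direction is not a sum of directions of shorter ones. -/
def RankCover {n : ℕ} (w u : Equiv.Perm (Fin n)) (p q : Fin n) : Prop :=
  RankArc w u p q ∧ ∀ s, Relation.TransGen (RankArc w u) p s →
    ¬ Relation.TransGen (RankArc w u) s q

theorem RankArc.restrict {n : ℕ} {w u : Equiv.Perm (Fin n)} {p q p' q' : Fin n}
    (h : RankArc w u p q) (hpp' : p ≤ p') (hpq : p' < q') (hqq' : q' ≤ q) (hu : u p ≤ u p')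
    (hu' : u q' ≤ u q) : RankArc w u p' q' := by
  refine ⟨hpq, fun k a h1 h2 h3 h4 => h.2 k a ?_ ?_ ?_ ?_⟩ <;>
    simp only [Fin.le_def, Fin.lt_def] at * <;> omega

theorem RankArc.lt_of_transGen {n : ℕ} {w u : Equiv.Perm (Fin n)} {p q : Fin n}
    (h : Relation.TransGen (RankArc w u) p q) : p < q := by
  induction h with
  | single h => exact h.1
  | tail _ h ih => exact ih.trans h.1

theorem RankCover.empty {n : ℕ} {w u : Equiv.Perm (Fin n)} {p q s : Fin n}
    (h : RankCover w u p q) (h1 : p < s) (h2 : s < q) (h3 : u p < u s) : ¬ u s < u q := fun h4 =>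
  h.2 s (.single (h.1.restrict le_rfl h1 h2.le le_rfl h4.le))
    (.single (h.1.restrict h1.le h2 le_rfl h3.le le_rfl))

/-- Of two upward covers leaving `p`, the nearer end point lies in the rectangle of the other cover
or to the north-west of its end point. Either way the longer cover decomposes. -/
theorem RankCover.out_unique {n : ℕ} {w u : Equiv.Perm (Fin n)} {p q q' : Fin n}
    (h : RankCover w u p q) (h' : RankCover w u p q') (hu : u p < u q) (hu' : u p < u q') :
    q = q' := by
  wlog hlt : q < q' generalizing q q'
  · by_contra hne
    exact hne (this h' h hu' hu (lt_of_le_of_ne (not_lt.1 hlt) (Ne.symm hne))).symm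
  rcases lt_trichotomy (u q) (u q') with h1 | h1 | h1
  · exact absurd h1 (h'.empty h.1.1 hlt hu)
  · exact u.injective h1
  · exact absurd (.single (rankArc_of_gt w hlt h1)) (h'.2 q (.single h.1))

theorem RankCover.in_unique {n : ℕ} {w u : Equiv.Perm (Fin n)} {p p' q : Fin n}
    (h : RankCover w u p q) (h' : RankCover w u p' q) (hu : u p < u q) (hu' : u p' < u q) :
    p = p' := by
  wlog hlt : p < p' generalizing p p'
  · by_contra hne
    exact hne (this h' h hu' hu (lt_of_le_of_ne (not_lt.1 hlt) (Ne.symm hne))).symm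
  rcases lt_trichotomy (u p) (u p') with h1 | h1 | h1
  · exact absurd hu' (h.empty hlt h'.1.1 h1)
  · exact u.injective h1
  · exact absurd (.single h'.1) (h.2 p' (.single (rankArc_of_gt w hlt h1)))

theorem exists_height_rankCover {n : ℕ} (w u : Equiv.Perm (Fin n)) (E : Fin n → Fin n → Prop) :
    ∃ f : Fin n → ℕ, (∀ p q, RankArc w u p q → f p ≤ f q) ∧
      (∀ p q, RankCover w u p q → u p < u q → E p q → f p = f q) ∧
      ∀ p q, RankCover w u p q → ¬ (u p < u q ∧ E p q) → f p < f q := by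
  let U : Fin n → Fin n → Prop := fun p q => RankCover w u p q ∧ u p < u q
  have hin : ∀ a b c, U a c → U b c → a = b := fun a b c h h' => h.1.in_unique h'.1 h.2 h'.2
  obtain ⟨f, hfU, hfD⟩ := exists_height u u.injective U (fun a b h => ⟨h.1.1.1, h.2⟩)
    (fun a b s h h1 h2 h3 => h.1.empty h1 h2 h3) (fun a b c h h' => h.1.out_unique h'.1 h.2 h'.2)
    -- Crossing paths would decompose `a → b` as `a → d → c → b`, whose outer steps are inversions
    -- and hence arcs.
    hin (fun a b c d h h' h1 h2 h3 h4 => h.1.2 c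
      (.tail (.single (rankArc_of_gt w h1 h2)) h'.1.1) (.single (rankArc_of_gt w h3 h4)))
  have hle : ∀ a b, Relation.ReflTransGen U a b → a ≤ b := by
    intro a b h
    induction h with
    | refl => exact le_rfl
    | tail _ h ih => exact ih.trans h.1.1.1.le
  obtain ⟨g, hgn, hg⟩ := exists_arc_count U E (fun a b h h' => (hle _ _ h).not_gt h'.1.1.1) hin
  rw [Fintype.card_fin] at hgn
  -- Since `g ≤ n`, the factor `n + 1` keeps every strict increase of `f`; `g` only matters inside a
  -- path.
  let F : Fin n → ℕ := fun p => (n + 1) * f p + g p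
  have hFD : ∀ p q, p < q → u q < u p → F p < F q := by
    intro p q h1 h2
    have h3 := hfD p q h1 h2
    have h4 := hgn p
    have h5 : (n + 1) * (f p + 1) ≤ (n + 1) * f q := Nat.mul_le_mul_left _ h3
    rw [mul_add] at h5
    simp only [F]
    omega
  have hFE : ∀ p q, RankCover w u p q → u p < u q → E p q → F p = F q := fun p q h1 h2 h3 => by
    simp only [F]
    rw [hfU p q ⟨h1, h2⟩, (hg p q ⟨h1, h2⟩).1 h3]
  have hFN : ∀ p q, RankCover w u p q → ¬ (u p < u q ∧ E p q) → F p < F q := by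
    intro p q h1 h2
    rcases lt_or_gt_of_ne (u.injective.ne h1.1.1.ne) with h3 | h3
    · simp only [F]
      rw [hfU p q ⟨h1, h3⟩]
      have := (hg p q ⟨h1, h3⟩).2 fun h => h2 ⟨h3, h⟩
      omega
    · exact hFD p q h1.1.1 h3
  refine ⟨F, fun p q h => ?_, hFE, hFN⟩
  obtain ⟨d, hd⟩ : ∃ d, (q : ℕ) - p = d := ⟨_, rfl⟩
  induction d using Nat.strong_induction_on generalizing p q with
  | _ d ih =>
    by_cases hc : RankCover w u p q
    · by_cases hE : u p < u q ∧ E p q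
      · exact (hFE p q hc hE.1 hE.2).le
      · exact (hFN p q hc hE).le
    · have : ∃ s, Relation.TransGen (RankArc w u) p s ∧ Relation.TransGen (RankArc w u) s q := by
        by_contra! hcon
        exact hc ⟨h, hcon⟩
      obtain ⟨s, h1, h2⟩ := this
      have hpath : ∀ x y, Relation.TransGen (RankArc w u) x y → (y : ℕ) - x < d → F x ≤ F y := by
        intro x y hxy
        induction hxy with
        | single hxy => exact fun hlt => ih _ hlt _ _ hxy rfl
        | @tail b c hb hbc ihb =>
          intro hlt
          have h3 := RankArc.lt_of_transGen hb
          have h4 := hbc.1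
          rw [Fin.lt_def] at h3 h4
          exact (ihb (by omega)).trans (ih _ (by omega) _ _ hbc rfl)
      have h3 := RankArc.lt_of_transGen h1
      have h4 := RankArc.lt_of_transGen h2
      rw [Fin.lt_def] at h3 h4
      exact (hpath _ _ h1 (by omega)).trans (hpath _ _ h2 (by omega))

/-! ### Geometry -/

theorem permVec_injective {n : ℕ} : Function.Injective (permVec : Equiv.Perm (Fin n) → _) := by
  intro u v h
  refine inv_injective (Equiv.ext fun i => Fin.ext ?_)
  have := congrFun h i
  simpa [permVec] using this

theorem permVec_mul_swap {n : ℕ} (u : Equiv.Perm (Fin n)) {p q : Fin n} (hpq : p ≠ q) :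
    permVec (u * Equiv.swap p q) = permVec u
      + ((q : ℝ) - p) • (Pi.single (u p) 1 - Pi.single (u q) 1 : Fin n → ℝ) := by
  ext y
  obtain ⟨x, rfl⟩ := u.surjective y
  have h1 : (u * Equiv.swap p q)⁻¹ (u x) = Equiv.swap p q x := by
    rw [Equiv.Perm.inv_eq_iff_eq]
    simp
  have h2 : u⁻¹ (u x) = x := u.symm_apply_apply x
  simp only [permVec, h1, h2, Pi.add_apply, Pi.smul_apply, Pi.sub_apply, Pi.single_apply,
    u.injective.eq_iff, Equiv.swap_apply_def, smul_eq_mul]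
  by_cases hp : x = p
  · subst hp
    simp [hpq]
    ring
  · by_cases hq : x = q
    · subst hq
      simp [hp]
      ring
    · simp [hp, hq]

theorem sum_permVec_sq {n : ℕ} (u : Equiv.Perm (Fin n)) :
    ∑ i, permVec u i ^ 2 = ∑ i : Fin n, ((i : ℝ) + 1) ^ 2 :=
  Equiv.sum_comp u⁻¹ fun i : Fin n => ((i : ℝ) + 1) ^ 2

/-- All the vectors `permVec u` lie on one sphere, and a segment between two points of a sphere
meets it only at its ends. -/
theorem permVec_mem_segment {n : ℕ} {u v z : Equiv.Perm (Fin n)}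
    (h : permVec z ∈ segment ℝ (permVec u) (permVec v)) : z = u ∨ z = v := by
  obtain ⟨a, b, ha, hb, hab, h⟩ := h
  have h1 : ∀ i, permVec z i = a * permVec u i + b * permVec v i := fun i => by
    rw [← h]
    simp
  have h2 : a * b * ∑ i, (permVec u i - permVec v i) ^ 2 = 0 := by
    have h3 : ∑ i, permVec z i ^ 2 = a * ∑ i, permVec u i ^ 2 + b * ∑ i, permVec v i ^ 2
        - a * b * ∑ i, (permVec u i - permVec v i) ^ 2 := by
      rw [Finset.mul_sum, Finset.mul_sum, Finset.mul_sum, ← Finset.sum_add_distrib,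
        ← Finset.sum_sub_distrib]
      refine Finset.sum_congr rfl fun i _ => ?_
      rw [h1, show b = 1 - a by linarith]
      ring
    rw [sum_permVec_sq, sum_permVec_sq, sum_permVec_sq, ← add_mul, hab] at h3
    linarith
  rcases mul_eq_zero.1 h2 with h2 | h2
  · rcases mul_eq_zero.1 h2 with rfl | rfl
    · right
      apply permVec_injective
      rw [← h, show b = 1 by linarith]
      simp
    · left
      apply permVec_injective
      rw [← h, show a = 1 by linarith]
      simp
  · left
    rw [Finset.sum_eq_zero_iff_of_nonneg fun i _ => sq_nonneg _] at h2
    apply permVec_injective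
    ext i
    have h3 := pow_eq_zero_iff (two_ne_zero) |>.1 (h2 i (Finset.mem_univ i))
    rw [h1, show permVec v i = permVec u i by linarith, ← add_mul, hab, one_mul]

theorem IsEdge.symm {d : ℕ} {Q : Set (Fin d → ℝ)} {x y : Fin d → ℝ} (h : IsEdge Q x y) :
    IsEdge Q y x :=
  ⟨h.1.symm, segment_symm ℝ x y ▸ h.2⟩

theorem right_mem_extremePoints_segment {V : Type*} [AddCommGroup V] [Module ℝ V] (x y : V) :
    y ∈ (segment ℝ x y).extremePoints ℝ := by
  rw [mem_extremePoints_iff_left]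
  refine ⟨right_mem_segment ℝ x y, fun x₁ h₁ x₂ h₂ h => ?_⟩
  rw [segment_eq_image'] at h₁ h₂
  obtain ⟨s, ⟨hs0, hs1⟩, rfl⟩ := h₁
  obtain ⟨t, ⟨ht0, ht1⟩, rfl⟩ := h₂
  obtain ⟨a, b, ha, hb, hab, h⟩ := h
  have h3 : (a * s + b * t - 1) • (y - x) = 0 := by
    have h4 : a • (x + s • (y - x)) + b • (x + t • (y - x)) - y
        = (a * s + b * t - 1) • (y - x) + (a + b - 1) • x := by module
    rw [h, sub_self, hab, sub_self, zero_smul, add_zero] at h4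
    exact h4.symm
  rcases smul_eq_zero.1 h3 with h3 | h3
  · have : s = 1 := by nlinarith
    simp [this]
  · simp [sub_eq_zero.1 h3]

theorem IsEdge.right_mem_extremePoints {d : ℕ} {Q : Set (Fin d → ℝ)} {x y : Fin d → ℝ}
    (h : IsEdge Q x y) : y ∈ Q.extremePoints ℝ :=
  h.2.isExtreme.extremePoints_subset_extremePoints (right_mem_extremePoints_segment x y)

theorem permVec_mem_bruhatIntervalPolytope {n : ℕ} {u w : Equiv.Perm (Fin n)} (h : RankLE u w) :
    permVec u ∈ bruhatIntervalPolytope w :=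
  subset_convexHull ℝ _ ⟨u, h.bruhatLE, rfl⟩

theorem exists_permVec_of_mem_extremePoints {n : ℕ} {w : Equiv.Perm (Fin n)} {x : Fin n → ℝ}
    (h : x ∈ (bruhatIntervalPolytope w).extremePoints ℝ) :
    ∃ u, RankLE u w ∧ x = permVec u := by
  obtain ⟨u, hu, rfl⟩ := extremePoints_convexHull_subset h
  exact ⟨u, .of_bruhatLE hu, rfl⟩

theorem exists_rankCover_of_isEdge {n : ℕ} {u w : Equiv.Perm (Fin n)} (hu : RankLE u w)
    {y : Fin n → ℝ} (h : IsEdge (bruhatIntervalPolytope w) (permVec u) y) :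
    ∃ p q, RankCover w u p q ∧ y = permVec (u * Equiv.swap p q) := by
  obtain ⟨v, hv, rfl⟩ := exists_permVec_of_mem_extremePoints h.right_mem_extremePoints
  obtain ⟨hne, hexp⟩ := h
  obtain ⟨l, hl⟩ := hexp ⟨_, left_mem_segment ℝ _ _⟩
  have hmax : ∀ z ∈ bruhatIntervalPolytope w, l z ≤ l (permVec u) :=
    (hl.subset (left_mem_segment ℝ _ _)).2
  have hlv : l (permVec v) = l (permVec u) :=
    le_antisymm (hmax _ (permVec_mem_bruhatIntervalPolytope hv))
      ((hl.subset (right_mem_segment ℝ _ _)).2 _ (permVec_mem_bruhatIntervalPolytope hu))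
  let g : Fin n → ℝ := fun p => l (Pi.single (u p) 1)
  have hlg : ∀ p q : Fin n, p ≠ q →
      l (permVec (u * Equiv.swap p q)) = l (permVec u) + ((q : ℝ) - p) * (g p - g q) := by
    intro p q hpq
    rw [permVec_mul_swap u hpq]
    simp [g]
  have hpos : ∀ p q : Fin n, p < q → (0 : ℝ) < (q : ℝ) - p := fun p q h => by
    rw [sub_pos]
    exact_mod_cast h
  have hmem : ∀ p q, RankArc w u p q →
      permVec (u * Equiv.swap p q) ∈ bruhatIntervalPolytope w := fun p q h =>
    permVec_mem_bruhatIntervalPolytope ((rankLE_mul_swap_iff hu h.1).2 h)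
  have hg : ∀ p q, RankArc w u p q → g p ≤ g q := by
    intro p q h
    have h1 := hmax _ (hmem p q h)
    rw [hlg p q h.1.ne] at h1
    have := hpos p q h.1
    nlinarith
  have hface : ∀ p q, RankArc w u p q → g p = g q → u * Equiv.swap p q = v := by
    intro p q h hgpq
    have h1 : permVec (u * Equiv.swap p q) ∈ segment ℝ (permVec u) (permVec v) := by
      rw [hl]
      refine ⟨hmem p q h, fun z hz => ?_⟩
      rw [hlg p q h.1.ne, hgpq]
      simpa using hmax z hz
    rcases permVec_mem_segment h1 with h2 | h2
    · rw [mul_eq_left, Equiv.swap_eq_one_iff] at h2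
      exact absurd h2 h.1.ne
    · exact h2
  -- If every arc strictly lowered `l`, every nonzero vector of the cone at `u` would, including
  -- `permVec v - permVec u`, on which `l` vanishes.
  have hex : ∃ p q, RankArc w u p q ∧ g p = g q := by
    by_contra! hcon
    have hcl : ∀ x ∈ AddSubmonoid.closure {x : Fin n → ℝ | ∃ p q, RankArc w u p q ∧
        x = Pi.single (u p) 1 - Pi.single (u q) 1}, x = 0 ∨ l x < 0 := by
      intro x hx
      induction hx using AddSubmonoid.closure_induction with
      | mem x hx =>
        obtain ⟨p, q, h, rfl⟩ := hx
        right
        rw [map_sub, sub_neg]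
        exact lt_of_le_of_ne (hg p q h) (hcon p q h)
      | zero => exact Or.inl rfl
      | add x y _ _ hx hy =>
        rcases hx with rfl | hx
        · simpa using hy
        · rcases hy with rfl | hy
          · right
            simpa using hx
          · right
            rw [map_add]
            linarith
    rcases hcl _ (permVec_sub_permVec_mem_closure hu hv) with h1 | h1
    · exact hne (sub_eq_zero.1 h1).symm
    · rw [map_sub, hlv, sub_self] at h1
      exact lt_irrefl _ h1
  obtain ⟨p, q, hpq, hgpq⟩ := hex
  have hpath : ∀ x y, Relation.TransGen (RankArc w u) x y → g x ≤ g y := by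
    intro x y h
    induction h with
    | single h => exact hg _ _ h
    | tail _ h ih => exact ih.trans (hg _ _ h)
  refine ⟨p, q, ⟨hpq, fun s h1 h2 => ?_⟩, by rw [hface p q hpq hgpq]⟩
  have hsq := RankArc.lt_of_transGen h2
  -- If the arc decomposed, `g` would be constant along the chain, so its first step would also lie
  -- on the edge and end at the same vertex `v`. This forces `s₁ = q`, although `s₁ < q`.
  obtain ⟨s₁, hs₁, hs₁s⟩ := Relation.TransGen.head'_iff.1 h1
  have h3 : Relation.TransGen (RankArc w u) s₁ q := Relation.TransGen.trans_right hs₁s h2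
  have h4 : g p = g s₁ := le_antisymm (hg _ _ hs₁) (hgpq ▸ hpath _ _ h3)
  have h5 := (hface p s₁ hs₁ h4).trans (hface p q hpq hgpq).symm
  have h6 := Equiv.congr_fun (mul_left_cancel h5) p
  rw [Equiv.swap_apply_left, Equiv.swap_apply_left] at h6
  exact (RankArc.lt_of_transGen h3).ne h6

theorem costVec_dotProduct_permVec_mul_swap_sub {n : ℕ} (u : Equiv.Perm (Fin n)) {p q : Fin n}
    (hpq : p ≠ q) : costVec n ⬝ᵥ (permVec (u * Equiv.swap p q) - permVec u)
      = ((q : ℝ) - p) * ((u q : ℝ) - u p) := by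
  rw [permVec_mul_swap u hpq, add_sub_cancel_left, dotProduct_smul, dotProduct_sub,
    dotProduct_single, dotProduct_single, costVec, costVec, smul_eq_mul]
  ring

theorem isPolytope_bruhatIntervalPolytope {n : ℕ} (w : Equiv.Perm (Fin n)) :
    IsPolytope (bruhatIntervalPolytope w) := by
  refine ⟨_, (Set.finite_range permVec).subset ?_, rfl⟩
  rintro _ ⟨u, _, rfl⟩
  exact ⟨u, rfl⟩

theorem isGenericCost_bruhatIntervalPolytope {n : ℕ} (w : Equiv.Perm (Fin n)) :
    IsGenericCost (bruhatIntervalPolytope w) (costVec n) := by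
  intro x y h
  obtain ⟨u, hu, rfl⟩ := exists_permVec_of_mem_extremePoints h.symm.right_mem_extremePoints
  obtain ⟨p, q, hpq, rfl⟩ := exists_rankCover_of_isEdge hu h
  rw [costVec_dotProduct_permVec_mul_swap_sub u hpq.1.1.ne]
  refine mul_ne_zero (sub_ne_zero.2 ?_) (sub_ne_zero.2 ?_)
  · exact_mod_cast Fin.val_injective.ne hpq.1.1.ne'
  · exact_mod_cast Fin.val_injective.ne (u.injective.ne hpq.1.1.ne')

theorem theorem5 (n : ℕ) (w : Equiv.Perm (Fin n)) :
    IsDirectionallySimple (bruhatIntervalPolytope w) (costVec n) := by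
  refine ⟨isPolytope_bruhatIntervalPolytope w, isGenericCost_bruhatIntervalPolytope w, ?_⟩
  intro v hv E hE
  obtain ⟨u, hu, rfl⟩ := exists_permVec_of_mem_extremePoints hv
  obtain ⟨f, hf, hfE, hfN⟩ :=
    exists_height_rankCover w u fun p q => permVec (u * Equiv.swap p q) ∈ E
  -- The coefficient at coordinate `u p` is the height `f p`, so `l` is nonpositive on the
  -- generators of the cone and `u` maximizes it.
  let l : StrongDual ℝ (Fin n → ℝ) :=
    ∑ i, (f (u⁻¹ i) : ℝ) • ContinuousLinearMap.proj (R := ℝ) (φ := fun _ : Fin n => ℝ) i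
  have hl : ∀ p, l (Pi.single (u p) 1) = f p := by
    intro p
    simp [l, Pi.single_apply]
  have hlswap : ∀ p q : Fin n, p ≠ q → l (permVec (u * Equiv.swap p q))
      = l (permVec u) + ((q : ℝ) - p) * (f p - f q) := by
    intro p q hpq
    rw [permVec_mul_swap u hpq, map_add, map_smul, map_sub, hl, hl, smul_eq_mul]
  have hmax : ∀ z ∈ bruhatIntervalPolytope w, l z ≤ l (permVec u) := by
    refine convexHull_min ?_ (convex_halfSpace_le l.toLinearMap.isLinear _)
    rintro _ ⟨v, hv, rfl⟩
    have hcl : ∀ x ∈ AddSubmonoid.closure {x : Fin n → ℝ | ∃ p q, RankArc w u p q ∧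
        x = Pi.single (u p) 1 - Pi.single (u q) 1}, l x ≤ 0 := by
      intro x hx
      induction hx using AddSubmonoid.closure_induction with
      | mem x hx =>
        obtain ⟨p, q, h, rfl⟩ := hx
        rw [map_sub, hl, hl, sub_nonpos]
        exact_mod_cast hf p q h
      | zero => simp
      | add x y _ _ hx hy =>
        rw [map_add]
        linarith
    have := hcl _ (permVec_sub_permVec_mem_closure hu (.of_bruhatLE hv))
    rwa [map_sub, sub_nonpos] at this
  have hexp := ContinuousLinearMap.toExposed.isExposed (𝕜 := ℝ) (l := l)
    (A := bruhatIntervalPolytope w)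
  have huF : permVec u ∈ l.toExposed (bruhatIntervalPolytope w) :=
    ⟨permVec_mem_bruhatIntervalPolytope hu, hmax⟩
  refine ⟨_, hexp, huF, Set.ext fun y => ⟨fun ⟨hy, hseg⟩ => ?_, fun hy => ⟨(hE y hy).1, ?_⟩⟩⟩
  · obtain ⟨p, q, hpq, rfl⟩ := exists_rankCover_of_isEdge hu hy
    by_contra hyE
    have h1 := (hseg (right_mem_segment ℝ _ _)).2 _ huF.1
    rw [hlswap p q hpq.1.1.ne] at h1
    have h2 : (f p : ℝ) < f q := by exact_mod_cast hfN p q hpq fun h => hyE h.2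
    have h3 : (p : ℝ) < q := by exact_mod_cast hpq.1.1
    nlinarith
  · obtain ⟨hedge, hup⟩ := hE y hy
    obtain ⟨p, q, hpq, rfl⟩ := exists_rankCover_of_isEdge hu hedge
    have h3 : (p : ℝ) < q := by exact_mod_cast hpq.1.1
    have hupq : u p < u q := by
      rw [← sub_pos, ← dotProduct_sub, costVec_dotProduct_permVec_mul_swap_sub u hpq.1.1.ne] at hup
      have h4 : (u p : ℝ) < u q := sub_pos.1 (pos_of_mul_pos_right hup (sub_pos.2 h3).le)
      exact_mod_cast h4
    have hyF : permVec (u * Equiv.swap p q) ∈ l.toExposed (bruhatIntervalPolytope w) := by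
      refine ⟨permVec_mem_bruhatIntervalPolytope ((rankLE_mul_swap_iff hu hpq.1.1).2 hpq.1),
        fun z hz => ?_⟩
      rw [hlswap p q hpq.1.1.ne, hfE p q hpq hupq hy]
      simpa using hmax z hz
    exact (hexp.convex (convex_convexHull ℝ _)).segment_subset huF hyF
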